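/- Let $G$ be a three-dimensional Lie group with a bi-invariant Riemannian metric $\langle\cdot,\cdot\rangle$ and Lie algebra $\mathfrak g$. Vectors along a curve in $G$ are read in $\mathfrak g$ by left translation; for $W=\sum_i w_iX_i$ with $X_i$ left invariant write $\dot W=\sum_i w_i'X_i$, so that $D_TW=\dot W+\tfrac12[T,W]$ along a curve with velocity $T$. For a smooth arc-length parametrized curve with Frenet apparatus $(T,N,B,\kappa,\tau)$, $\kappa>0$ (that is, $(T,N,B)$ is orthonormal and $D_TT=\kappa N$, $D_TN=-\kappa T+\tau B$, $D_TB=-\tau N$), put $\tau_G=\tfrac12\langle[T,N],B\rangle$ and $H=(\tau-\tau_G)/\kappa$. A development of a curve in $G$ is a curve in $\mathfrak g$ whose derivative is the left-translated velocity of the given curve. Let $\alpha$ and $\tilde\alpha$ be smooth curves in $G$ on open intervals $I$ and $J$, with arc-length parameters $s$ and $s^*$ and Frenet apparatus $(T,N,B,\kappa,\tau)$ and $(\tilde T,\tilde N,\tilde B,\tilde\kappa,\tilde\tau)$. Suppose that they form a Bertrand pair: there is a smooth bijection $s^*\mapsto s(s^*)$ from $J$ onto $I$, and there are developments $a$ of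 $\alpha$ and $\tilde a$ of $\tilde\alpha$ such that for every $s^*\in J$ the principal normal lines $a(s(s^*))+\mathbb R\,N(s(s^*))$ and $\tilde a(s^*)+\mathbb R\,\tilde N(s^*)$ in $\mathfrak g$ are equal, and $a(s(s^*))\ne\tilde a(s^*)$ for some $s^*\in J$. Suppose that $\tilde\kappa'\neq0$ on $J$, let $\rho=(\tilde\tau-\tilde\tau_G)'/\tilde\kappa'$, and suppose that $\rho\ne\tilde H$ on $J$, where $\tilde H=(\tilde\tau-\tilde\tau_G)/\tilde\kappa$. Then there is $\delta\in\{1,-1\}$ such that for all $s^*\in J$ $$T(s(s^*))=\frac{-\delta}{\sqrt{1+\rho^2}}\,\bigl(\tilde T-\rho\tilde B\bigr)(s^*),\qquad \frac{ds}{ds^*}=\delta\,\frac{\tilde H\sqrt{1+\rho^2}}{\rho-\tilde H},$$ and for all $s_0^*,s_1^*\in J$ the integrand below is integrable between $s_0^*$ and $s_1^*$ and $$s(s_1^*)-s(s_0^*)=\delta\int_{s_0^*}^{s_1^*}\frac{\tilde H\sqrt{1+\rho^2}}{\rho-\tilde H}\,ds^*.$$ Thus $s=\int\frac{\tilde H\sqrt{1+\rho^2}}{\rho-\tilde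 H}\,ds^*$ when $\alpha$ is oriented so that $\delta=1$, that is, so that $T=\frac{-1}{\sqrt{1+\rho^2}}(\tilde T-\rho\tilde B)$. -/

import Mathlib

open Set MeasureTheory
open scoped Manifold ContDiff Bundle

noncomputable section

namespace BertrandLie

variable {G : Type*} [TopologicalSpace G] [ChartedSpace (EuclideanSpace ℝ (Fin 3)) G] [Group G]

/-- The Lie algebra of the three-dimensional Lie group `G`. -/
abbrev LieAlg (G : Type*) [TopologicalSpace G] [ChartedSpace (EuclideanSpace ℝ (Fin 3)) G]
    [Group G] : Type _ := GroupLieAlgebra (𝓡 3) G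

/-- Smooth Riemannian metrics on the three-dimensional Lie group `G`. -/
abbrev Metric (G : Type*) [TopologicalSpace G] [ChartedSpace (EuclideanSpace ℝ (Fin 3)) G]
    [Group G] [LieGroup (𝓡 3) ∞ G] : Type _ :=
  Bundle.ContMDiffRiemannianMetric (𝓡 3) ∞ (EuclideanSpace ℝ (Fin 3))
    (fun x : G => TangentSpace (𝓡 3) x)

/-- All left and all right translations are isometries of the metric. -/
def IsBiInvariant [LieGroup (𝓡 3) ∞ G] (g : Metric G) : Prop :=
  (∀ (a x : G) (v w : TangentSpace (𝓡 3) x),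
    g.inner (a * x) (mfderiv (𝓡 3) (𝓡 3) (fun y => a * y) x v)
      (mfderiv (𝓡 3) (𝓡 3) (fun y => a * y) x w) = g.inner x v w) ∧
  (∀ (a x : G) (v w : TangentSpace (𝓡 3) x),
    g.inner (x * a) (mfderiv (𝓡 3) (𝓡 3) (fun y => y * a) x v)
      (mfderiv (𝓡 3) (𝓡 3) (fun y => y * a) x w) = g.inner x v w)

/-- The inner product which the metric induces on the Lie algebra. -/
def ip [LieGroup (𝓡 3) ∞ G] (g : Metric G) (X Y : LieAlg G) : ℝ := g.inner (1 : G) X Y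

/-- The velocity `α'(t)`, a tangent vector at `α t`. -/
def velocity (α : ℝ → G) (t : ℝ) : TangentSpace (𝓡 3) (α t) :=
  mfderiv 𝓘(ℝ, ℝ) (𝓡 3) α t (1 : ℝ)

/-- The element of the Lie algebra that the left translation by `(α t)⁻¹` assigns to the velocity
`α'(t)`: for a basis `X₁, X₂, X₃` of left invariant fields and `α' = ∑ wᵢ Xᵢ` along `α`, it is
`∑ wᵢ Xᵢ` in the Lie algebra. -/
def leftVelocity (α : ℝ → G) (t : ℝ) : LieAlg G :=
  (mfderiv (𝓡 3) (𝓡 3) (fun y => (α t)⁻¹ * y) (α t) (velocity α t) :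
    EuclideanSpace ℝ (Fin 3))

/-- A vector field along a curve is written `W = ∑ wᵢ Xᵢ` with left invariant `Xᵢ`, that is as a
function with values in the Lie algebra. Here `deriv W = ∑ wᵢ' Xᵢ`, and the value is the
covariant derivative of `W` along `α` for the Levi-Civita connection, `D_X Y = [X, Y] / 2` on left
invariant fields, of a bi-invariant metric. -/
def covDeriv (α : ℝ → G) (W : ℝ → LieAlg G) (t : ℝ) : LieAlg G :=
  deriv W t + (1 / 2 : ℝ) • ⁅leftVelocity α t, W t⁆

/-- Smoothness on `J` of a field along a curve: all its components are smooth. -/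
def IsSmoothField [LieGroup (𝓡 3) ∞ G] (g : Metric G) (J : Set ℝ) (W : ℝ → LieAlg G) : Prop :=
  ∀ X : LieAlg G, ContDiffOn ℝ ∞ (fun t => ip g (W t) X) J

/-- The data `(T, N, B, κ, τ)`; the vectors are read in the Lie algebra by left translation. -/
structure FrenetData (G : Type*) [TopologicalSpace G]
    [ChartedSpace (EuclideanSpace ℝ (Fin 3)) G] [Group G] where
  T : ℝ → LieAlg G
  N : ℝ → LieAlg G
  B : ℝ → LieAlg G
  κ : ℝ → ℝ
  τ : ℝ → ℝ

/-- `α` is a smooth curve parametrized by arc length on the open interval `J`, and `F` is its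
Frenet apparatus there (in particular the curvature is positive). -/
structure IsFrenetApparatus [LieGroup (𝓡 3) ∞ G] (g : Metric G) (J : Set ℝ) (α : ℝ → G)
    (F : FrenetData G) : Prop where
  isOpen : IsOpen J
  isInterval : J.OrdConnected
  smooth : ContMDiffOn 𝓘(ℝ, ℝ) (𝓡 3) ∞ α J
  arcLength : ∀ t ∈ J, g.inner (α t) (velocity α t) (velocity α t) = 1
  tangent : ∀ t ∈ J, F.T t = leftVelocity α t
  smooth_T : IsSmoothField g J F.T
  smooth_N : IsSmoothField g J F.N
  smooth_B : IsSmoothField g J F.B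
  norm_T : ∀ t ∈ J, ip g (F.T t) (F.T t) = 1
  norm_N : ∀ t ∈ J, ip g (F.N t) (F.N t) = 1
  norm_B : ∀ t ∈ J, ip g (F.B t) (F.B t) = 1
  orth_TN : ∀ t ∈ J, ip g (F.T t) (F.N t) = 0
  orth_TB : ∀ t ∈ J, ip g (F.T t) (F.B t) = 0
  orth_NB : ∀ t ∈ J, ip g (F.N t) (F.B t) = 0
  curvature_pos : ∀ t ∈ J, 0 < F.κ t
  frenet_T : ∀ t ∈ J, covDeriv α F.T t = F.κ t • F.N t
  frenet_N : ∀ t ∈ J, covDeriv α F.N t = -F.κ t • F.T t + F.τ t • F.B t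
  frenet_B : ∀ t ∈ J, covDeriv α F.B t = -F.τ t • F.N t

/-- `τ_G = ⟨[T, N], B⟩ / 2`. -/
def tauG [LieGroup (𝓡 3) ∞ G] (g : Metric G) (F : FrenetData G) (t : ℝ) : ℝ :=
  1 / 2 * ip g ⁅F.T t, F.N t⁆ (F.B t)

/-- The harmonic curvature `H = (τ - τ_G) / κ`. -/
def harmonicCurvature [LieGroup (𝓡 3) ∞ G] (g : Metric G) (F : FrenetData G) (t : ℝ) : ℝ :=
  (F.τ t - tauG g F t) / F.κ t

/-- `ρ = (τ - τ_G)' / κ'`. -/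
def rho [LieGroup (𝓡 3) ∞ G] (g : Metric G) (F : FrenetData G) (t : ℝ) : ℝ :=
  deriv (fun u => F.τ u - tauG g F u) t / deriv F.κ t

/-- `a` is a development of `α` on `J`: a curve in the Lie algebra whose derivative is the
left-translated velocity of `α`. It is unique up to a constant, and for the vector group `ℝ³` it is
`α` up to a translation. -/
def IsDevelopment (J : Set ℝ) (α : ℝ → G) (a : ℝ → LieAlg G) : Prop :=
  ∀ t ∈ J, HasDerivAt a (leftVelocity α t) t

/-- The straight line in the Lie algebra through `p` in the direction `n`. -/
def line (p n : LieAlg G) : Set (LieAlg G) := {x | ∃ r : ℝ, x = p + r • n}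

/-- The curves `α` (on `I`, with principal normal `N`) and `β` (on `J`, with principal normal `M`)
form a Bertrand pair with corresponding points `α (φ t)` and `β t`. Expressions such as
`β + c M`, in which a vector field along a curve is added to the curve, are differentiated in
the left trivialization, `(β + c M)' = β' + c M'` with `M' = ∑ mᵢ' Xᵢ` for `M = ∑ mᵢ Xᵢ`; so they are
formed with the developments. The pair is a Bertrand pair if the principal normal lines at
corresponding points are equal and the two curves are different. -/
structure IsBertrandPair (I J : Set ℝ) (α β : ℝ → G) (N M : ℝ → LieAlg G) (φ : ℝ → ℝ) :
    Prop where
  bijOn : BijOn φ J I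
  smooth : ContDiffOn ℝ ∞ φ J
  common_normals : ∃ a b : ℝ → LieAlg G, IsDevelopment I α a ∧ IsDevelopment J β b ∧
    (∀ t ∈ J, line (a (φ t)) (N (φ t)) = line (b t) (M t)) ∧ ∃ t ∈ J, a (φ t) ≠ b t

end BertrandLie

end

/-! Write `σ = τ - τ_G`. In the left trivialization the bracket terms only shift the torsion: `[T,
T] = 0` gives `T' = κ N`, and pairing the equation of `N` with `B` gives `⟨N', B⟩ = σ`.
Orthonormality forces the rest, so the frame obeys the Euclidean Frenet equations with torsion `σ`
(`euclideanFrenet_of_deriv_add`), and the developments are a Euclidean Bertrand pair in the Lie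
algebra. Classically, `a ∘ φ = ã + l Ñ` and `T ∘ φ = u T̃ + v B̃` with constant `l ≠ 0`, `u`, `v`;
differentiating the former gives `φ' u = 1 - l κ̃` and `φ' v = l σ̃` (`bertrand_mate_constants`,
`common_normals_constants`). Eliminating `φ'` and differentiating shows `ρ = -v / u`. With `u² + v²
= 1` this fixes `u` and `v` up to one sign `δ`, and eliminating `l` gives `φ'`
(`bertrand_mate_solve`). -/

namespace BertrandLie

/-! ### Frenet frames and Bertrand mates in a three-dimensional Euclidean space. -/

section Frame

variable {E : Type*} [NormedAddCommGroup E] [NormedSpace ℝ E]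

/-- An orthonormal triple for a bilinear form. -/
structure OrthonormalTriple (b : E →L[ℝ] E →L[ℝ] ℝ) (x y z : E) : Prop where
  xx : b x x = 1
  yy : b y y = 1
  zz : b z z = 1
  xy : b x y = 0
  xz : b x z = 0
  yz : b y z = 0

theorem OrthonormalTriple.expand {b : E →L[ℝ] E →L[ℝ] ℝ} (hb : ∀ v w, b v w = b w v)
    (hE : Module.finrank ℝ E = 3) {x y z : E} (h : OrthonormalTriple b x y z) (v : E) :
    v = b v x • x + b v y • y + b v z • z := by
  have yx := (hb y x).trans h.xy
  have zx := (hb z x).trans h.xz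
  have zy := (hb z y).trans h.yz
  have hli : LinearIndependent ℝ ![x, y, z] := by
    rw [Fintype.linearIndependent_iff]
    intro c hc
    simp only [Fin.sum_univ_three, Matrix.cons_val_zero, Matrix.cons_val_one,
      Matrix.cons_val] at hc
    have h0 := congrArg (fun w => b w x) hc
    have h1 := congrArg (fun w => b w y) hc
    have h2 := congrArg (fun w => b w z) hc
    simp [h.xx, h.yy, h.zz, h.xy, h.xz, h.yz, yx, zx, zy] at h0 h1 h2
    intro i
    fin_cases i <;> assumption
  have hs := hli.span_eq_top_of_card_eq_finrank (by simp [hE])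
  have hv : v ∈ Submodule.span ℝ (Set.range ![x, y, z]) := by rw [hs]; trivial
  obtain ⟨c, rfl⟩ := (Submodule.mem_span_range_iff_exists_fun ℝ).1 hv
  simp [Fin.sum_univ_three, h.xx, h.yy, h.zz, h.xy, h.xz, h.yz, yx, zx, zy]

/-- The triple is fixed while `W` varies, so it serves as a constant basis in which `W` has
differentiable coordinates. -/
theorem OrthonormalTriple.differentiableAt {b : E →L[ℝ] E →L[ℝ] ℝ} (hb : ∀ v w, b v w = b w v)
    (hE : Module.finrank ℝ E = 3) {x y z : E} (h : OrthonormalTriple b x y z) {W : ℝ → E} {t : ℝ}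
    (hW : ∀ v, DifferentiableAt ℝ (fun s => b (W s) v) t) : DifferentiableAt ℝ W t := by
  have : W = fun s => b (W s) x • x + b (W s) y • y + b (W s) z • z :=
    funext fun s => h.expand hb hE (W s)
  rw [this]
  exact (((hW x).smul_const x).add ((hW y).smul_const y)).add ((hW z).smul_const z)

/-- Two fields with constant product have opposite products with each other's derivatives. -/
theorem bilin_deriv_add_eq_zero {b : E →L[ℝ] E →L[ℝ] ℝ} {J : Set ℝ} (hJ : IsOpen J)
    {V W : ℝ → E} {V' W' : E} {t c : ℝ} (ht : t ∈ J) (hV : HasDerivAt V V' t)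
    (hW : HasDerivAt W W' t) (hc : ∀ s ∈ J, b (V s) (W s) = c) :
    b (V t) W' + b V' (W t) = 0 := by
  have h1 := b.hasDerivAt_of_bilinear (u := V) (v := W) (fun _ => hV) fun _ => hW
  have h2 : HasDerivAt (fun s => b (V s) (W s)) 0 t :=
    (hasDerivAt_const t c).congr_of_eventuallyEq
      (Filter.eventually_of_mem (hJ.mem_nhds ht) hc)
  exact h1.unique h2

/-- `(T, N, B)` is an orthonormal frame field on `J` which satisfies the Frenet equations of a
three-dimensional Euclidean space with curvature `κ` and torsion `σ`. -/
structure EuclideanFrenet (b : E →L[ℝ] E →L[ℝ] ℝ) (J : Set ℝ) (T N B : ℝ → E) (κ σ : ℝ → ℝ) :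
    Prop where
  frame : ∀ t ∈ J, OrthonormalTriple b (T t) (N t) (B t)
  deriv_T : ∀ t ∈ J, HasDerivAt T (κ t • N t) t
  deriv_N : ∀ t ∈ J, HasDerivAt N (-κ t • T t + σ t • B t) t
  deriv_B : ∀ t ∈ J, HasDerivAt B (-σ t • N t) t

/-- Frenet equations in which an arbitrary vector is added to the derivative of the normal have,
for an orthonormal frame, the form of the Euclidean ones with a modified torsion. -/
theorem euclideanFrenet_of_deriv_add {b : E →L[ℝ] E →L[ℝ] ℝ} (hb : ∀ v w, b v w = b w v)
    (hE : Module.finrank ℝ E = 3) {J : Set ℝ} (hJ : IsOpen J) {T N B C : ℝ → E} {κ τ : ℝ → ℝ}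
    (hF : ∀ t ∈ J, OrthonormalTriple b (T t) (N t) (B t))
    (hT : ∀ v, ∀ t ∈ J, DifferentiableAt ℝ (fun s => b (T s) v) t)
    (hN : ∀ v, ∀ t ∈ J, DifferentiableAt ℝ (fun s => b (N s) v) t)
    (hB : ∀ v, ∀ t ∈ J, DifferentiableAt ℝ (fun s => b (B s) v) t)
    (hT' : ∀ t ∈ J, deriv T t = κ t • N t)
    (hN' : ∀ t ∈ J, deriv N t + (1 / 2 : ℝ) • C t = -κ t • T t + τ t • B t) :
    EuclideanFrenet b J T N B κ (fun t => τ t - 1 / 2 * b (C t) (B t)) := by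
  have key : ∀ t ∈ J, HasDerivAt T (κ t • N t) t ∧
      HasDerivAt N (-κ t • T t + (τ t - 1 / 2 * b (C t) (B t)) • B t) t ∧
      HasDerivAt B (-(τ t - 1 / 2 * b (C t) (B t)) • N t) t := by
    intro t ht
    have h := hF t ht
    have dT := (h.differentiableAt hb hE fun v => hT v t ht).hasDerivAt
    have dN := (h.differentiableAt hb hE fun v => hN v t ht).hasDerivAt
    have dB := (h.differentiableAt hb hE fun v => hB v t ht).hasDerivAt
    rw [hT' t ht] at dT
    have TN := bilin_deriv_add_eq_zero hJ ht dT dN fun s hs => (hF s hs).xy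
    have TB := bilin_deriv_add_eq_zero hJ ht dT dB fun s hs => (hF s hs).xz
    have NN := bilin_deriv_add_eq_zero hJ ht dN dN fun s hs => (hF s hs).yy
    have NB := bilin_deriv_add_eq_zero hJ ht dN dB fun s hs => (hF s hs).yz
    have BB := bilin_deriv_add_eq_zero hJ ht dB dB fun s hs => (hF s hs).zz
    simp only [map_smul, smul_eq_mul, smul_apply, h.yy, h.yz] at TN TB
    rw [hb _ (deriv N t)] at TN NN
    rw [hb _ (deriv B t)] at TB NB BB
    -- Only this component of `C` matters; the relations above determine the other components of
    -- `N'` and all of `B'`.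
    have hNB : b (deriv N t) (B t) = τ t - 1 / 2 * b (C t) (B t) := by
      have := congrArg (fun w => b w (B t)) (hN' t ht)
      simp only [map_add, map_smul, smul_eq_mul, smul_apply, add_apply, h.xz, h.zz] at this
      linarith
    have eN : deriv N t = -κ t • T t + (τ t - 1 / 2 * b (C t) (B t)) • B t := by
      rw [h.expand hb hE (deriv N t), hNB, show b (deriv N t) (T t) = -κ t by linarith,
        show b (deriv N t) (N t) = 0 by linarith]
      simp
    have eB : deriv B t = -(τ t - 1 / 2 * b (C t) (B t)) • N t := by
      rw [h.expand hb hE (deriv B t), show b (deriv B t) (T t) = 0 by linarith,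
        show b (deriv B t) (B t) = 0 by linarith,
        show b (deriv B t) (N t) = -b (deriv N t) (B t) by linarith, hNB]
      simp
    exact ⟨dT, eN ▸ dN, eB ▸ dB⟩
  exact ⟨hF, fun t ht => (key t ht).1, fun t ht => (key t ht).2.1, fun t ht => (key t ht).2.2⟩

/-- A function with vanishing derivative on an open interval is constant. -/
theorem exists_const_of_hasDerivAt_zero {J : Set ℝ} (hJ : IsOpen J) (hJ' : J.OrdConnected)
    {f : ℝ → ℝ} (hf : ∀ t ∈ J, HasDerivAt f 0 t) : ∃ c, ∀ t ∈ J, f t = c := by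
  obtain ⟨c, hc⟩ := hJ.exists_is_const_of_deriv_eq_zero hJ'.isPreconnected
    (fun t ht => (hf t ht).differentiableAt.differentiableWithinAt) (fun t ht => (hf t ht).deriv)
  exact ⟨c, hc⟩

/-- Bertrand mates in a three-dimensional Euclidean space: the distance along the common normals
and the angle between the tangents are constant. Here `p` is a unit speed curve with Frenet frame
`(T, N, B)`, and `q` is the mate, with velocity `w • P` for the unit tangent `P`. -/
theorem bertrand_mate_constants {b : E →L[ℝ] E →L[ℝ] ℝ} (hb : ∀ v w, b v w = b w v)
    (hE : Module.finrank ℝ E = 3) {J : Set ℝ} (hJ : IsOpen J) (hJ' : J.OrdConnected)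
    {p q T N B P : ℝ → E} {κ σ w c : ℝ → ℝ} (hfr : EuclideanFrenet b J T N B κ σ)
    (hp : ∀ t ∈ J, HasDerivAt p (T t) t)
    (hq : ∀ t ∈ J, HasDerivAt q (w t • P t) t)
    (hP : ∀ t ∈ J, HasDerivAt P (c t • N t) t)
    (hPP : ∀ t ∈ J, b (P t) (P t) = 1) (hPN : ∀ t ∈ J, b (P t) (N t) = 0)
    (hpq : ∀ t ∈ J, ∃ r : ℝ, q t = p t + r • N t) (hne : ∃ t ∈ J, q t ≠ p t) :
    ∃ l u v : ℝ, l ≠ 0 ∧ u ^ 2 + v ^ 2 = 1 ∧ ∀ t ∈ J, P t = u • T t + v • B t ∧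
      w t * u = 1 - l * κ t ∧ w t * v = l * σ t := by
  obtain ⟨hF, hT, hN, hB⟩ := hfr
  have hbN : ∀ t ∈ J, ∀ r : ℝ, q t = p t + r • N t → b (q t - p t) (N t) = r := by
    intro t ht r hr
    simp [hr, (hF t ht).yy]
  have hd : ∀ t ∈ J, HasDerivAt (fun s => q s - p s) (w t • P t - T t) t :=
    fun t ht => (hq t ht).sub (hp t ht)
  -- The velocity `w P - T` of `q - p` is orthogonal to `N`, and `q - p`, a multiple of `N`, is
  -- orthogonal to `N'`.
  obtain ⟨l, hl⟩ := exists_const_of_hasDerivAt_zero hJ hJ'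
    (f := fun t => b (q t - p t) (N t)) (by
      intro t ht
      obtain ⟨r, hr⟩ := hpq t ht
      have h := hF t ht
      refine (b.hasDerivAt_of_bilinear (fun _ => hd t ht) fun _ => hN t ht).congr_deriv ?_
      have hNT : b (N t) (T t) = 0 := (hb _ _).trans h.xy
      simp [hr, h.yz, h.xy, hNT, hPN t ht])
  -- `P'`, `T'` and `B'` are all multiples of `N`, which is orthogonal to `P`, `T` and `B`; so the
  -- products of `P` with `T` and `B` are constant.
  obtain ⟨u, hu⟩ := exists_const_of_hasDerivAt_zero hJ hJ'
    (f := fun t => b (P t) (T t)) (by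
      intro t ht
      have h := hF t ht
      refine (b.hasDerivAt_of_bilinear (fun _ => hP t ht) fun _ => hT t ht).congr_deriv ?_
      have hNT : b (N t) (T t) = 0 := (hb _ _).trans h.xy
      simp [hNT, hPN t ht])
  obtain ⟨v, hv⟩ := exists_const_of_hasDerivAt_zero hJ hJ'
    (f := fun t => b (P t) (B t)) (by
      intro t ht
      have h := hF t ht
      refine (b.hasDerivAt_of_bilinear (fun _ => hP t ht) fun _ => hB t ht).congr_deriv ?_
      simp [h.yz, hPN t ht])
  have hq' : ∀ t ∈ J, q t = p t + l • N t := by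
    intro t ht
    obtain ⟨r, hr⟩ := hpq t ht
    rw [← hl t ht, hbN t ht r hr, hr]
  have hPe : ∀ t ∈ J, P t = u • T t + v • B t := by
    intro t ht
    rw [(hF t ht).expand hb hE (P t), hu t ht, hv t ht, hPN t ht]
    simp
  obtain ⟨t₀, ht₀, hne⟩ := hne
  refine ⟨l, u, v, ?_, ?_, fun t ht => ⟨hPe t ht, ?_⟩⟩
  · rintro rfl
    exact hne (by simpa using hq' t₀ ht₀)
  · have := hPP t₀ ht₀
    have h := hF t₀ ht₀
    have hBT : b (B t₀) (T t₀) = 0 := (hb _ _).trans h.xz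
    rw [hPe t₀ ht₀] at this
    simp [h.xx, h.zz, h.xz, hBT] at this
    linarith
  · have h := hF t ht
    have hNT : b (N t) (T t) = 0 := (hb _ _).trans h.xy
    have hBT : b (B t) (T t) = 0 := (hb _ _).trans h.xz
    -- The two expressions for `q'` are compared in their `T` and `B` components.
    have h1 : HasDerivAt q (T t + l • (-κ t • T t + σ t • B t)) t :=
      ((hp t ht).add ((hN t ht).const_smul l)).congr_of_eventuallyEq
        (Filter.eventually_of_mem (hJ.mem_nhds ht) hq')
    have h2 := (hq t ht).unique h1
    rw [hPe t ht] at h2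
    have h3 := congrArg (fun x => b x (T t)) h2
    have h4 := congrArg (fun x => b x (B t)) h2
    simp [h.xx, h.zz, h.xz, hBT] at h3 h4
    exact ⟨by linarith, by linarith⟩

/-- Two curves in a three-dimensional Euclidean space with common principal normal lines. -/
theorem common_normals_constants {b : E →L[ℝ] E →L[ℝ] ℝ} (hb : ∀ v w, b v w = b w v)
    (hE : Module.finrank ℝ E = 3) {I J : Set ℝ} (hJ : IsOpen J) (hJ' : J.OrdConnected)
    {p q T N B T₁ N₁ B₁ : ℝ → E} {κ σ κ₁ σ₁ φ w : ℝ → ℝ} (hfr : EuclideanFrenet b J T N B κ σ)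
    (hfr₁ : EuclideanFrenet b I T₁ N₁ B₁ κ₁ σ₁)
    (hp : ∀ t ∈ J, HasDerivAt p (T t) t) (hq : ∀ t ∈ I, HasDerivAt q (T₁ t) t)
    (hφ : ∀ t ∈ J, HasDerivAt φ (w t) t) (hI : ∀ t ∈ J, φ t ∈ I)
    (hline : ∀ t ∈ J, {x | ∃ r : ℝ, x = q (φ t) + r • N₁ (φ t)} =
      {x | ∃ r : ℝ, x = p t + r • N t})
    (hne : ∃ t ∈ J, q (φ t) ≠ p t) :
    ∃ l u v : ℝ, l ≠ 0 ∧ u ^ 2 + v ^ 2 = 1 ∧ ∀ t ∈ J, T₁ (φ t) = u • T t + v • B t ∧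
      w t * u = 1 - l * κ t ∧ w t * v = l * σ t := by
  have hpos : ∀ t ∈ J, ∃ r : ℝ, q (φ t) = p t + r • N t := by
    intro t ht
    have h1 : q (φ t) ∈ {x | ∃ r : ℝ, x = q (φ t) + r • N₁ (φ t)} := ⟨0, by simp⟩
    rwa [hline t ht] at h1
  have hdir : ∀ t ∈ J, ∃ c : ℝ, N₁ (φ t) = c • N t := by
    intro t ht
    obtain ⟨r, hr⟩ := hpos t ht
    -- Two points of the common line, with parameters `0` and `1`, differ by `N₁`, hence by a
    -- multiple of `N`.
    have h2 : q (φ t) + N₁ (φ t) ∈ {x | ∃ r : ℝ, x = q (φ t) + r • N₁ (φ t)} := ⟨1, by simp⟩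
    rw [hline t ht] at h2
    obtain ⟨r', hr'⟩ := h2
    refine ⟨r' - r, ?_⟩
    rw [hr, add_assoc, add_right_inj] at hr'
    rw [sub_smul, ← hr', add_sub_cancel_left]
  choose! c hc using hdir
  refine bertrand_mate_constants hb hE hJ hJ' (q := fun t => q (φ t)) (P := fun t => T₁ (φ t))
    (c := fun t => w t * κ₁ (φ t) * c t) hfr hp (fun t ht => (hq _ (hI t ht)).scomp t (hφ t ht))
    (fun t ht => ?_) (fun t ht => (hfr₁.frame _ (hI t ht)).xx) (fun t ht => ?_) hpos hne
  · have := (hfr₁.deriv_T _ (hI t ht)).scomp t (hφ t ht)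
    rwa [hc t ht, smul_smul, smul_smul] at this
  · have h1 := (hfr₁.frame _ (hI t ht)).xy
    have h2 := (hfr₁.frame _ (hI t ht)).yy
    rw [hc t ht] at h1 h2
    have hc0 : c t ≠ 0 := by
      intro h0
      simp [h0] at h2
    simpa [hc0] using h1

end Frame

/-! ### Algebraic elimination of the constants. -/

/-- The relations between curvature, torsion and parameter change of Bertrand mates, solved for the
tangent direction `(u, v)` and for the speed `w` in terms of `ρ = σ' / κ'`. -/
theorem bertrand_mate_solve {J : Set ℝ} (hJ : IsOpen J) {κ σ w : ℝ → ℝ} {l u v : ℝ}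
    (hl : l ≠ 0) (huv : u ^ 2 + v ^ 2 = 1) (hne : J.Nonempty)
    (hu : ∀ t ∈ J, w t * u = 1 - l * κ t) (hv : ∀ t ∈ J, w t * v = l * σ t)
    (hκ : ∀ t ∈ J, 0 < κ t) (hκ' : ∀ t ∈ J, deriv κ t ≠ 0)
    (hρ : ∀ t ∈ J, deriv σ t / deriv κ t - σ t / κ t ≠ 0) :
    ∃ δ : ℝ, (δ = 1 ∨ δ = -1) ∧ ∀ t ∈ J,
      u = -δ / √(1 + (deriv σ t / deriv κ t) ^ 2) ∧ v = -u * (deriv σ t / deriv κ t) ∧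
      w t = δ * (σ t / κ t * √(1 + (deriv σ t / deriv κ t) ^ 2) /
        (deriv σ t / deriv κ t - σ t / κ t)) := by
  have hrel : ∀ t ∈ J, u * (l * σ t) = v * (1 - l * κ t) := by
    intro t ht
    rw [← hu t ht, ← hv t ht]; ring
  -- If `u = 0`, then `κ = 1 / l` is constant, against `κ' ≠ 0`.
  have hu0 : u ≠ 0 := by
    rintro rfl
    obtain ⟨t, ht⟩ := hne
    have h1 : ∀ s ∈ J, κ s = 1 / l := by
      intro s hs
      have := hu s hs
      field_simp
      linarith
    refine hκ' t ht ?_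
    exact ((hasDerivAt_const t (1 / l)).congr_of_eventuallyEq
      (Filter.eventually_of_mem (hJ.mem_nhds ht) h1)).deriv
  have hρv : ∀ t ∈ J, deriv σ t / deriv κ t = -v / u := by
    intro t ht
    have h1 : ∀ s ∈ J, σ s = v / (u * l) * (1 - l * κ s) := by
      intro s hs
      have := hrel s hs
      field_simp
      linarith
    have hd := (differentiableAt_of_deriv_ne_zero (hκ' t ht)).hasDerivAt
    have h2 : HasDerivAt σ (v / (u * l) * (-(l * deriv κ t))) t :=
      (((hd.const_mul l).const_sub 1).const_mul (v / (u * l))).congr_of_eventuallyEq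
        (Filter.eventually_of_mem (hJ.mem_nhds ht) h1)
    have := hκ' t ht
    rw [h2.deriv]
    field_simp
  have hR : 0 < √(1 + (-v / u) ^ 2) := Real.sqrt_pos.2 (by positivity)
  have hR2 : √(1 + (-v / u) ^ 2) ^ 2 = 1 + (-v / u) ^ 2 := Real.sq_sqrt (by positivity)
  have huR : (u * √(1 + (-v / u) ^ 2)) ^ 2 = 1 := by
    rw [mul_pow, hR2]
    field_simp
    exact huv
  -- The value forced by `u = -δ / √(1 + ρ²)`; it does not depend on `t` because `ρ = -v / u`.
  refine ⟨-(u * √(1 + (-v / u) ^ 2)), ?_, fun t ht => ?_⟩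
  · rcases sq_eq_one_iff.1 huR with h | h <;> simp [h]
  · have h0 := hρ t ht
    rw [hρv t ht] at h0 ⊢
    refine ⟨by field_simp, by field_simp, ?_⟩
    set R := √(1 + (-v / u) ^ 2)
    have hk := (hκ t ht).ne'
    rw [show -(u * R) * (σ t / κ t * R / (-v / u - σ t / κ t)) =
      -u * (σ t / κ t) * R ^ 2 / (-v / u - σ t / κ t) by ring, eq_div_iff h0]
    have e : u * R ^ 2 = 1 / u := by
      field_simp
      linarith
    rw [show -u * (σ t / κ t) * R ^ 2 = -(u * R ^ 2) * (σ t / κ t) by ring, e]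
    field_simp
    have h1 := hu t ht
    have h2 := hv t ht
    -- In this combination the terms in `κ σ` cancel, which leaves `w (u σ + v κ) = σ` times `l`.
    have h3 : l * (w t * (-(v * κ t) - u * σ t) + σ t) = 0 := by
      linear_combination (-l * κ t) * h2 - (l * σ t) * h1
    have := (mul_eq_zero.1 h3).resolve_left hl
    linarith

end BertrandLie

/-! ### Passage from the Lie group to its Lie algebra. -/

namespace BertrandLie

section LieGroup

variable {G : Type*} [TopologicalSpace G] [ChartedSpace (EuclideanSpace ℝ (Fin 3)) G] [Group G]
  [LieGroup (𝓡 3) ∞ G]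

/-- The inner product of the Lie algebra, as a continuous bilinear form on the model space. -/
def ipE (g : Metric G) :
    EuclideanSpace ℝ (Fin 3) →L[ℝ] EuclideanSpace ℝ (Fin 3) →L[ℝ] ℝ := g.inner (1 : G)

theorem ipE_symm (g : Metric G) (X Y : EuclideanSpace ℝ (Fin 3)) : ipE g X Y = ipE g Y X :=
  g.symm 1 X Y

variable {g : Metric G} {J : Set ℝ} {α : ℝ → G} {F : FrenetData G}

theorem IsSmoothField.differentiableAt {W : ℝ → LieAlg G} (hW : IsSmoothField g J W)
    (hJ : IsOpen J) (X : LieAlg G) (t : ℝ) (ht : t ∈ J) :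
    DifferentiableAt ℝ (fun s => ip g (W s) X) t :=
  ((hW X).contDiffAt (hJ.mem_nhds ht)).differentiableAt (by simp)

theorem IsFrenetApparatus.deriv_T (h : IsFrenetApparatus g J α F) {t : ℝ} (ht : t ∈ J) :
    deriv F.T t = F.κ t • F.N t := by
  have h1 := h.frenet_T t ht
  have h2 : ⁅leftVelocity α t, F.T t⁆ = 0 := by
    rw [← h.tangent t ht, GroupLieAlgebra.bracket_def, VectorField.mlieBracket_self]
    rfl
  rwa [covDeriv, h2, smul_zero, add_zero] at h1

/-- Read in the Lie algebra, the Frenet frame satisfies the Euclidean Frenet equations with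
torsion `τ - τ_G`. -/
theorem IsFrenetApparatus.euclideanFrenet (h : IsFrenetApparatus g J α F) :
    EuclideanFrenet (E := EuclideanSpace ℝ (Fin 3)) (ipE g) J F.T F.N F.B F.κ
      (fun t => F.τ t - tauG g F t) :=
  euclideanFrenet_of_deriv_add (E := EuclideanSpace ℝ (Fin 3)) (C := fun t => (⁅F.T t, F.N t⁆ : LieAlg G))
    (ipE_symm g) finrank_euclideanSpace_fin h.isOpen
    (fun t ht => ⟨h.norm_T t ht, h.norm_N t ht, h.norm_B t ht, h.orth_TN t ht, h.orth_TB t ht,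
      h.orth_NB t ht⟩)
    (h.smooth_T.differentiableAt h.isOpen) (h.smooth_N.differentiableAt h.isOpen)
    (h.smooth_B.differentiableAt h.isOpen) (fun _ ht => h.deriv_T ht)
    (fun t ht => by
      have h1 := h.frenet_N t ht
      rw [covDeriv, ← h.tangent t ht] at h1
      exact h1)

end LieGroup

end BertrandLie

theorem corollary3p2
    {G : Type*} [TopologicalSpace G] [ChartedSpace (EuclideanSpace ℝ (Fin 3)) G] [Group G]
    [LieGroup (𝓡 3) ∞ G]
    (g : BertrandLie.Metric G) (hg : BertrandLie.IsBiInvariant g)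
    (I J : Set ℝ) (α αt : ℝ → G) (F Ft : BertrandLie.FrenetData G)
    (hα : BertrandLie.IsFrenetApparatus g I α F)
    (hαt : BertrandLie.IsFrenetApparatus g J αt Ft)
    (φ : ℝ → ℝ) (hpair : BertrandLie.IsBertrandPair I J α αt F.N Ft.N φ)
    (hκ : ∀ t ∈ J, deriv Ft.κ t ≠ 0)
    (hρ : ∀ t ∈ J, BertrandLie.rho g Ft t - BertrandLie.harmonicCurvature g Ft t ≠ 0) :
    ∃ δ : ℝ, (δ = 1 ∨ δ = -1) ∧
      (∀ t ∈ J, F.T (φ t) = (-δ / √(1 + BertrandLie.rho g Ft t ^ 2)) •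
        (Ft.T t - BertrandLie.rho g Ft t • Ft.B t)) ∧
      (∀ t ∈ J, HasDerivAt φ (δ * (BertrandLie.harmonicCurvature g Ft t *
        √(1 + BertrandLie.rho g Ft t ^ 2) /
          (BertrandLie.rho g Ft t - BertrandLie.harmonicCurvature g Ft t))) t) ∧
      (∀ t₀ ∈ J, ∀ t₁ ∈ J,
        IntervalIntegrable (fun t => BertrandLie.harmonicCurvature g Ft t *
          √(1 + BertrandLie.rho g Ft t ^ 2) /
            (BertrandLie.rho g Ft t - BertrandLie.harmonicCurvature g Ft t)) volume t₀ t₁ ∧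
        φ t₁ - φ t₀ = δ * ∫ t in t₀..t₁, BertrandLie.harmonicCurvature g Ft t *
          √(1 + BertrandLie.rho g Ft t ^ 2) /
            (BertrandLie.rho g Ft t - BertrandLie.harmonicCurvature g Ft t)) := by
  obtain ⟨a, b, ha, hb, hline, hne⟩ := hpair.common_normals
  have hJ := hαt.isOpen
  have hφ : ∀ t ∈ J, HasDerivAt φ (deriv φ t) t := fun t ht =>
    ((hpair.smooth.contDiffAt (hJ.mem_nhds ht)).differentiableAt (by simp)).hasDerivAt
  have hI : ∀ t ∈ J, φ t ∈ I := fun t ht => hpair.bijOn.mapsTo ht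
  -- The development `b` of `αt` is the unit speed base curve, and `a ∘ φ` is its mate with speed
  -- factor `φ'`.
  obtain ⟨l, u, v, hl, huv, hconst⟩ := BertrandLie.common_normals_constants
    (BertrandLie.ipE_symm g) finrank_euclideanSpace_fin hJ hαt.isInterval
    (p := b) (q := a) hαt.euclideanFrenet hα.euclideanFrenet
    (fun t ht => by rw [hαt.tangent t ht]; exact hb t ht)
    (fun t ht => by rw [hα.tangent t ht]; exact ha t ht) hφ hI hline hne
  obtain ⟨δ, hδ, hsol⟩ := BertrandLie.bertrand_mate_solve hJ hl huv
    (hne.imp fun _ h => h.1) (fun t ht => (hconst t ht).2.1) (fun t ht => (hconst t ht).2.2)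
    hαt.curvature_pos hκ hρ
  have hderiv : ∀ t ∈ J, deriv φ t = δ * (BertrandLie.harmonicCurvature g Ft t *
      √(1 + BertrandLie.rho g Ft t ^ 2) /
        (BertrandLie.rho g Ft t - BertrandLie.harmonicCurvature g Ft t)) :=
    fun t ht => (hsol t ht).2.2
  refine ⟨δ, hδ, fun t ht => ?_, fun t ht => hderiv t ht ▸ hφ t ht, fun t₀ h₀ t₁ h₁ => ?_⟩
  · obtain ⟨h1, h2, -⟩ := hsol t ht
    have h3 : u = -δ / √(1 + BertrandLie.rho g Ft t ^ 2) := h1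
    have h4 : v = -u * BertrandLie.rho g Ft t := h2
    have h5 : F.T (φ t) = u • Ft.T t + v • Ft.B t := (hconst t ht).1
    rw [h5, ← h3, h4, smul_sub, smul_smul, neg_mul, neg_smul,
      ← sub_eq_add_neg]
  · have hsub : uIcc t₀ t₁ ⊆ J := hαt.isInterval.uIcc_subset h₀ h₁
    -- Integrability comes from the continuity of `φ'`, since the integrand is `δ φ'` by `δ² = 1`.
    have hcont : ContinuousOn (deriv φ) (uIcc t₀ t₁) :=
      (hpair.smooth.continuousOn_deriv_of_isOpen hJ (by simp)).mono hsub
    have hδ2 : δ * δ = 1 := by rcases hδ with h | h <;> simp [h]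
    have hint := hcont.intervalIntegrable (μ := volume)
    constructor
    · refine (hint.const_mul δ).congr fun t ht => ?_
      simp only [hderiv t (hsub (uIoc_subset_uIcc ht)), ← mul_assoc, hδ2, one_mul]
    · rw [← intervalIntegral.integral_eq_sub_of_hasDerivAt (fun t ht => hφ t (hsub ht)) hint,
        ← intervalIntegral.integral_const_mul]
      exact intervalIntegral.integral_congr fun t ht => hderiv t (hsub ht)
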